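/- Theorem 1. There exist an infinite dimensional complex Hilbert space $H$, a unitary operator $V$ on $H$, and a bounded linear operator $R$ on $H$ of rank at most $2$ such that $T=V+R$ is hypercyclic, that is, there is $x\in H$ whose orbit $\{T^nx : n\ge 0\}$ is dense in $H$. Consequently, Salas' question whether a finite rank perturbation of a hyponormal operator can be supercyclic has an affirmative answer: there exist an infinite dimensional complex Hilbert space $H$, a bounded linear operator $A$ on $H$ which is hyponormal (that is, $\|Ax\|\ge\|A^*x\|$ for all $x\in H$), and a bounded linear operator $F$ on $H$ of finite rank such that $A+F$ is supercyclic, that is, there is $x\in H$ for which the projective orbit $\{\lambda (A+F)^nx : \lambda\in\mathbb C,\ n\ge 0\}$ is dense in $H$. -/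

import Mathlib

/-- A continuous linear operator `T` on a complex topological vector space is hypercyclic if some
orbit `{T ^ n x : n ≥ 0}` is dense. -/
def IsHypercyclic {X : Type*} [AddCommGroup X] [Module ℂ X] [TopologicalSpace X]
    (T : X →L[ℂ] X) : Prop :=
  ∃ x : X, Dense {y : X | ∃ n : ℕ, y = (T ^ n) x}

/-- A continuous linear operator `T` on a complex topological vector space is supercyclic if some
projective orbit `{c • T ^ n x : c ∈ ℂ, n ≥ 0}` is dense. -/
def IsSupercyclic {X : Type*} [AddCommGroup X] [Module ℂ X] [TopologicalSpace X]
    (T : X →L[ℂ] X) : Prop :=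
  ∃ x : X, Dense {y : X | ∃ (c : ℂ) (n : ℕ), y = c • (T ^ n) x}

/-- A bounded operator `T` on a Hilbert space is hyponormal if `‖T* x‖ ≤ ‖T x‖` for all `x`. -/
def IsHyponormal {H : Type*} [NormedAddCommGroup H] [InnerProductSpace ℂ H] [CompleteSpace H]
    (T : H →L[ℂ] H) : Prop :=
  ∀ x : H, ‖ContinuousLinearMap.adjoint T x‖ ≤ ‖T x‖

/-!
The operator is a rank one perturbation of a unitary operator with a large supply of eigenvectors
whose eigenvalues are roots of unity.

*Construction.* Choose roots of unity `rₖ` (`rootSeq`) and poles `rₖ (1 + 4⁻ᵏ)`, and let `G` be the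
infinite product of the factors `(z - rₖ) / (z - rₖ (1 + 4⁻ᵏ))`, all bounded by `1` on the disc. The
product converges in `L²` of the circle, and so do the quotients `fₖ = G / (z - rₖ)`. With `S`
multiplication by `z` and `x(0)` the mean of `x` over the circle, so that `G(0) ≠ 0`, the operator
`T x = S⁻¹ (x - (x(0) / G(0)) G)` satisfies `T fₖ = rₖ⁻¹ fₖ`. On the closed span `M` of
the `fₖ`, `T` is isometric on the hyperplane `x(0) = 0`. It is bounded below because `G` has positive
distance from `M`
(`norm_evalAt_zero_partialProd_le`): on the circle `|G + ∑ aₖ fₖ|` is also the modulus of a function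
analytic in the disc whose value at `0` is `G(0)`. Hence `T` is invertible on `M`, and an invertible
operator which is isometric on a hyperplane is unitary plus rank one
(`exists_unitary_add_rank_le_one`).

*Dense orbit.* The bound `‖fₖ - fⱼ‖ ≤ |rₖ - rⱼ| 4ᵏ 4ʲ` allows the sequence `rₖ` to be chosen so that
for arbitrarily large `N` there are an exponent `n` with `rⱼⁿ = 1` for all `j < N`, and for every
such `j` a vector `fₖ` close to `fⱼ` with `rₖⁿ = -1`. Then `Tⁿ` fixes `fⱼ` and negates `fₖ`, so a
combination of the two is close to any given `a fⱼ` and has image close to any given `b fⱼ`. This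
yields topological transitivity (`isHypercyclic_of_eigenvectors`), and Baire's theorem gives a dense
orbit.
-/

/-! ### Dense orbits -/

/-- Birkhoff's transitivity theorem, by the Baire category theorem. -/
theorem exists_dense_orbit_of_transitive {X : Type*} [TopologicalSpace X] [BaireSpace X]
    [SecondCountableTopology X] [Nonempty X] (T : X → X) (hT : Continuous T)
    (h : ∀ U W : Set X, IsOpen U → U.Nonempty → IsOpen W → W.Nonempty →
      ∃ n : ℕ, ∃ x ∈ U, T^[n] x ∈ W) :
    ∃ x, Dense {y | ∃ n : ℕ, y = T^[n] x} := by
  have hopen : ∀ W ∈ TopologicalSpace.countableBasis X, IsOpen (⋃ n : ℕ, T^[n] ⁻¹' W) :=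
    fun W hW => isOpen_iUnion fun n =>
      (TopologicalSpace.isOpen_of_mem_countableBasis hW).preimage (hT.iterate n)
  have hdense : ∀ W ∈ TopologicalSpace.countableBasis X, Dense (⋃ n : ℕ, T^[n] ⁻¹' W) := by
    intro W hW
    rw [dense_iff_inter_open]
    intro U hU hUne
    obtain ⟨n, x, hxU, hxW⟩ := h U W hU hUne (TopologicalSpace.isOpen_of_mem_countableBasis hW)
      (TopologicalSpace.nonempty_of_mem_countableBasis hW)
    exact ⟨x, hxU, Set.mem_iUnion.2 ⟨n, hxW⟩⟩
  obtain ⟨x, hx⟩ := (dense_biInter_of_isOpen hopen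
    (TopologicalSpace.countable_countableBasis X) hdense).nonempty
  refine ⟨x, (TopologicalSpace.isBasis_countableBasis X).dense_iff.2 ?_⟩
  intro W hW _
  obtain ⟨n, hn⟩ := Set.mem_iUnion.1 (Set.mem_iInter₂.1 hx W hW)
  exact ⟨_, hn, n, rfl⟩

/-- A hypercyclicity criterion in terms of eigenvectors. If some power `T ^ n` fixes the first `N`
eigenvectors `f j` while it negates eigenvectors `f k` arbitrarily close to them, then for
`u = ∑ aⱼ fⱼ` and `v = ∑ bⱼ fⱼ` the vector `∑ (aⱼ + bⱼ) / 2 • fⱼ + (aⱼ - bⱼ) / 2 • f_{k(j)}` is close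
to `u` and is mapped by `T ^ n` to a vector close to `v`. -/
theorem isHypercyclic_of_eigenvectors {X : Type*} [NormedAddCommGroup X] [NormedSpace ℂ X]
    [CompleteSpace X] (T : X →L[ℂ] X) (f : ℕ → X) (ω : ℕ → ℂ)
    (hspan : Dense (Submodule.span ℂ (Set.range f) : Set X))
    (hf : ∀ k, T (f k) = ω k • f k)
    (hω : ∀ N : ℕ, ∀ ε > 0, ∃ n : ℕ, ∀ j < N, ω j ^ n = 1 ∧
      ∃ k, ω k ^ n = -1 ∧ ‖f k - f j‖ < ε) :
    IsHypercyclic T := by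
  have hpow : ∀ n k, (T ^ n) (f k) = ω k ^ n • f k := by
    intro n k
    induction n with
    | zero => simp
    | succ n ih => rw [pow_succ', mul_apply_eq_comp, ih, map_smul, hf, smul_smul,
        pow_succ]
  have hsep : TopologicalSpace.SeparableSpace X := by
    have h1 : TopologicalSpace.IsSeparable (Submodule.span ℂ (Set.range f) : Set X) :=
      (Set.countable_range f).isSeparable.span
    have h2 := h1.closure
    rw [hspan.closure_eq] at h2
    exact TopologicalSpace.isSeparable_univ_iff.1 h2
  have : SecondCountableTopology X := UniformSpace.secondCountable_of_separable X
  have hrep : ∀ x ∈ Submodule.span ℂ (Set.range f), ∃ N : ℕ, ∃ a : ℕ → ℂ,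
      ∀ M, N ≤ M → x = ∑ j ∈ Finset.range M, a j • f j := by
    intro x hx
    obtain ⟨c, rfl⟩ := (Finsupp.mem_span_range_iff_exists_finsupp).1 hx
    refine ⟨c.support.sup id + 1, c, fun M hM => ?_⟩
    refine Finset.sum_subset (fun i hi => ?_) (fun i _ hi => ?_)
    · have := Finset.le_sup (f := id) hi
      simp only [id] at this
      exact Finset.mem_range.2 (by omega)
    · simp [Finsupp.notMem_support_iff.1 hi]
  obtain ⟨x, hx⟩ := exists_dense_orbit_of_transitive T T.continuous (by
    intro U W hU hUne hW hWne
    obtain ⟨u, huU, hu⟩ := hspan.inter_open_nonempty U hU hUne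
    obtain ⟨v, hvW, hv⟩ := hspan.inter_open_nonempty W hW hWne
    obtain ⟨N₁, a, ha⟩ := hrep u hu
    obtain ⟨N₂, b, hb⟩ := hrep v hv
    obtain ⟨r, hr, hrU⟩ := Metric.isOpen_iff.1 hU u huU
    obtain ⟨s, hs, hsW⟩ := Metric.isOpen_iff.1 hW v hvW
    set N := max N₁ N₂
    have hu' := ha N (le_max_left _ _)
    have hv' := hb N (le_max_right _ _)
    set C := ∑ j ∈ Finset.range N, ‖(a j - b j) / 2‖
    have hC : 0 ≤ C := Finset.sum_nonneg fun _ _ => norm_nonneg _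
    set ε := min r s / (C + 1)
    have hε : 0 < ε := by positivity
    have hCε : C * ε < min r s := by
      have : (C + 1) * ε = min r s := by simp only [ε]; field_simp
      nlinarith
    obtain ⟨n, hn⟩ := hω N ε hε
    have hn' : ∀ j, ∃ k, j < N → ω j ^ n = 1 ∧ ω k ^ n = -1 ∧ ‖f k - f j‖ < ε := by
      intro j
      by_cases hj : j < N
      · obtain ⟨h1, k, hk⟩ := hn j hj
        exact ⟨k, fun _ => ⟨h1, hk⟩⟩
      · exact ⟨0, fun h => absurd h hj⟩
    choose k hk using hn'
    have hbound : ‖∑ j ∈ Finset.range N, ((a j - b j) / 2) • (f (k j) - f j)‖ ≤ C * ε := by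
      refine (norm_sum_le _ _).trans ?_
      rw [Finset.sum_mul]
      refine Finset.sum_le_sum fun j hj => ?_
      rw [norm_smul]
      exact mul_le_mul_of_nonneg_left (hk j (Finset.mem_range.1 hj)).2.2.le (norm_nonneg _)
    refine ⟨n, ∑ j ∈ Finset.range N, (((a j + b j) / 2) • f j + ((a j - b j) / 2) • f (k j)),
      hrU ?_, hsW ?_⟩
    · rw [Metric.mem_ball, dist_eq_norm, hu', ← Finset.sum_sub_distrib]
      refine lt_of_le_of_lt (le_of_eq_of_le ?_ hbound) (hCε.trans_le (min_le_left _ _))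
      congr 1
      refine Finset.sum_congr rfl fun j _ => ?_
      module
    · rw [Metric.mem_ball, dist_eq_norm, hv', ← FunLike.coe_pow_eq_iterate, map_sum,
        ← Finset.sum_sub_distrib]
      refine lt_of_le_of_lt (le_of_eq_of_le ?_ hbound) (hCε.trans_le (min_le_right _ _))
      rw [← norm_neg, ← Finset.sum_neg_distrib]
      congr 1
      refine Finset.sum_congr rfl fun j hj => ?_
      obtain ⟨h1, h2, -⟩ := hk j (Finset.mem_range.1 hj)
      rw [map_add, map_smul, map_smul, hpow, hpow, h1, h2]
      module)
  exact ⟨x, by simpa only [FunLike.coe_pow_eq_iterate] using hx⟩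

theorem IsHypercyclic.isSupercyclic {X : Type*} [AddCommGroup X] [Module ℂ X] [TopologicalSpace X]
    {T : X →L[ℂ] X} (h : IsHypercyclic T) : IsSupercyclic T := by
  obtain ⟨x, hx⟩ := h
  refine ⟨x, hx.mono ?_⟩
  rintro y ⟨n, rfl⟩
  exact ⟨1, n, (one_smul ℂ _).symm⟩

theorem isHyponormal_of_mem_unitary {H : Type*} [NormedAddCommGroup H] [InnerProductSpace ℂ H]
    [CompleteSpace H] {V : H →L[ℂ] H} (hV : V ∈ unitary (H →L[ℂ] H)) : IsHyponormal V := by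
  intro x
  rw [← ContinuousLinearMap.star_eq_adjoint,
    ContinuousLinearMap.norm_map_of_mem_unitary (Unitary.star_mem hV),
    ContinuousLinearMap.norm_map_of_mem_unitary hV]

/-! ### Rank one perturbations of unitary operators -/

/-- An invertible operator which is isometric on a hyperplane `aᗮ` is a rank one perturbation of a
unitary operator: keep `T` on `aᗮ`, and send the unit vector `a` to a unit vector orthogonal to
`T '' aᗮ`. -/
theorem exists_unitary_add_rank_le_one {M : Type*} [NormedAddCommGroup M] [InnerProductSpace ℂ M]
    [CompleteSpace M] (T : M ≃L[ℂ] M) (a : M) (ha : a ≠ 0)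
    (hT : ∀ x, inner ℂ a x = 0 → ‖T x‖ = ‖x‖) :
    ∃ V R : M →L[ℂ] M, V ∈ unitary (M →L[ℂ] M) ∧ LinearMap.rank (R : M →ₗ[ℂ] M) ≤ 1 ∧
      (T : M →L[ℂ] M) = V + R := by
  wlog hna : ‖a‖ = 1 generalizing a
  · have hna' : (‖a‖ : ℂ) ≠ 0 := by simpa using ha
    refine this ((‖a‖⁻¹ : ℂ) • a) (smul_ne_zero (inv_ne_zero hna') ha) (fun x hx => hT x ?_) ?_
    · rw [inner_smul_left] at hx
      simpa [ha] using hx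
    · rw [norm_smul]
      simp [ha]
  set b₀ : M := ContinuousLinearMap.adjoint (T.symm : M →L[ℂ] M) a with hb₀
  have hb₀T : ∀ w, inner ℂ b₀ w = inner ℂ a (T.symm w) := by
    intro w
    rw [hb₀, ContinuousLinearMap.adjoint_inner_left]
    rfl
  have haa : inner ℂ a a = (1 : ℂ) := by rw [inner_self_eq_norm_sq_to_K, hna]; simp
  have hb₀ne : b₀ ≠ 0 := by
    intro h
    have := hb₀T (T a)
    rw [h, inner_zero_left, T.symm_apply_apply, haa] at this
    exact zero_ne_one this
  have hb₀n : (‖b₀‖ : ℂ) ≠ 0 := by simpa using hb₀ne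
  set b : M := (‖b₀‖⁻¹ : ℂ) • b₀ with hb
  have hbn : ‖b‖ = 1 := by rw [hb, norm_smul]; simp [hb₀ne]
  have hbb : inner ℂ b b = (1 : ℂ) := by rw [inner_self_eq_norm_sq_to_K, hbn]; simp
  have hbT : ∀ w, inner ℂ b w = (‖b₀‖⁻¹ : ℂ) * inner ℂ a (T.symm w) := by
    intro w
    rw [hb, inner_smul_left, hb₀T]
    simp
  set R : M →L[ℂ] M := (innerSL ℂ a).smulRight (T a - b) with hR
  set V : M →L[ℂ] M := (T : M →L[ℂ] M) - R with hV
  have hVadd : ∀ (y : M) (α : ℂ), inner ℂ a y = 0 → V (y + α • a) = T y + α • b := by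
    intro y α hy
    simp only [hV, hR, _root_.sub_apply, ContinuousLinearMap.smulRight_apply,
      innerSL_apply_apply, hy, haa, map_add, map_smul, ContinuousLinearEquiv.coe_coe]
    module
  have hnorm : ∀ x, ‖V x‖ = ‖x‖ := by
    intro x
    set α : ℂ := inner ℂ a x
    set y : M := x - α • a with hy
    have hay : inner ℂ a y = 0 := by
      rw [hy, inner_sub_right, inner_smul_right, haa]; simp [α]
    have hx : x = y + α • a := by rw [hy]; abel
    rw [hx, hVadd y α hay, ← sq_eq_sq₀ (norm_nonneg _) (norm_nonneg _), sq, sq,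
      norm_add_sq_eq_norm_sq_add_norm_sq_of_inner_eq_zero (𝕜 := ℂ),
      norm_add_sq_eq_norm_sq_add_norm_sq_of_inner_eq_zero (𝕜 := ℂ), hT y hay, norm_smul α b,
      norm_smul α a, hna, hbn]
    · rw [inner_smul_right, inner_eq_zero_symm.1 hay, mul_zero]
    · rw [inner_smul_right, inner_eq_zero_symm.1, mul_zero]
      rw [hbT, T.symm_apply_apply, hay, mul_zero]
  have hsurj : Function.Surjective V := by
    intro w
    set α : ℂ := inner ℂ b w
    refine ⟨T.symm (w - α • b) + α • a, ?_⟩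
    rw [hVadd]
    · simp
    · have h := hbT (w - α • b)
      rw [inner_sub_right, inner_smul_right, hbb, mul_one, sub_self] at h
      exact (mul_eq_zero.1 h.symm).resolve_left (inv_ne_zero hb₀n)
  refine ⟨V, R, ?_, ?_, by rw [hV]; abel⟩
  · let e : M ≃ₗᵢ[ℂ] M := LinearIsometryEquiv.ofSurjective ⟨V.toLinearMap, hnorm⟩ hsurj
    have : V = (Unitary.linearIsometryEquiv.symm e : M →L[ℂ] M) := by ext x; rfl
    rw [this]
    exact SetLike.coe_mem _
  · have hle : LinearMap.range (R : M →ₗ[ℂ] M) ≤ Submodule.span ℂ {T a - b} := by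
      rintro _ ⟨x, rfl⟩
      exact Submodule.mem_span_singleton.2 ⟨inner ℂ a x, rfl⟩
    exact (Submodule.rank_mono hle).trans ((rank_span_le _).trans (by simp))

/-- Given an isometry `S` which acts on each `f k` as multiplication by `lam k` up to a common
error `G`, the operator `x ↦ S⁻¹ (x - (⟪e, x⟫ / ⟪e, G⟫) • G)` has the `f k` as eigenvectors. On the
closed span of the `f k` it is bounded below, because `G` keeps a positive distance from the span,
hence invertible; and it is isometric on the orthogonal complement of `e`. -/
theorem exists_unitary_add_rank_le_one_eigenvectors {H : Type*} [NormedAddCommGroup H]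
    [InnerProductSpace ℂ H] [CompleteSpace H] (S : H ≃ₗᵢ[ℂ] H) (e G : H) (f : ℕ → H) (lam : ℕ → ℂ)
    (hlam : ∀ k, lam k ≠ 0) (hS : ∀ k, S (f k) = G + lam k • f k)
    (he : ∀ k, lam k * inner ℂ e (f k) = -inner ℂ e G) (heG : inner ℂ e G ≠ 0) {c : ℝ}
    (hc : 0 < c) (hG : ∀ m ∈ Submodule.span ℂ (Set.range f), c ≤ ‖G + m‖)
    (M : Submodule ℂ H) [CompleteSpace M]
    (hM : M = (Submodule.span ℂ (Set.range f)).topologicalClosure) :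
    ∃ V R : M →L[ℂ] M, V ∈ unitary (M →L[ℂ] M) ∧ LinearMap.rank (R : M →ₗ[ℂ] M) ≤ 1 ∧
      ∀ (k : ℕ) (x : M), (x : H) = f k → (V + R) x = (lam k)⁻¹ • x := by
  set E := Submodule.span ℂ (Set.range f) with hE
  have hEM : E ≤ M := hM ▸ E.le_topologicalClosure
  have hfE : ∀ k, f k ∈ E := fun k => Submodule.subset_span ⟨k, rfl⟩
  have hMclosed : IsClosed (M : Set H) := hM ▸ E.isClosed_topologicalClosure
  have hMcl : (M : Set H) = closure (E : Set H) := by rw [hM, E.topologicalClosure_coe]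
  have hGM : ∀ m ∈ M, c ≤ ‖G + m‖ := fun m hm =>
    closure_minimal (s := (E : Set H)) (t := {m | c ≤ ‖G + m‖}) hG
      (isClosed_le continuous_const (by fun_prop)) (hMcl ▸ hm)
  have hGM' : ∀ m ∈ M, ∀ α : ℂ, c * ‖α‖ ≤ ‖α • G + m‖ := by
    intro m hm α
    by_cases hα : α = 0
    · simp [hα]
    · have h := hGM (α⁻¹ • m) (M.smul_mem _ hm)
      have h2 : α • G + m = α • (G + α⁻¹ • m) := by rw [smul_add, smul_inv_smul₀ hα]
      rw [h2, norm_smul, mul_comm]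
      exact mul_le_mul_of_nonneg_left h (norm_nonneg _)
  let T₀ : H →L[ℂ] H := (S.symm : H →L[ℂ] H) ∘L
    (ContinuousLinearMap.id ℂ H - (innerSL ℂ e).smulRight ((inner ℂ e G)⁻¹ • G))
  have hT₀ : ∀ x, T₀ x = S.symm (-(inner ℂ e x / inner ℂ e G) • G + x) := by
    intro x
    have : x - inner ℂ e x • ((inner ℂ e G)⁻¹ • G) = -(inner ℂ e x / inner ℂ e G) • G + x := by
      rw [div_eq_mul_inv]
      module
    rw [← this]
    rfl
  have hT₀f : ∀ k, T₀ (f k) = (lam k)⁻¹ • f k := by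
    intro k
    have h1 : inner ℂ e (f k) / inner ℂ e G = -(lam k)⁻¹ := by
      have := he k
      field_simp [hlam k]
      linear_combination this
    rw [hT₀, h1, LinearIsometryEquiv.symm_apply_eq, map_smul, hS, smul_add, inv_smul_smul₀ (hlam k),
      neg_neg]
  have hE_inv : E ≤ E.comap (T₀ : H →ₗ[ℂ] H) := by
    rw [hE, Submodule.span_le]
    rintro _ ⟨k, rfl⟩
    rw [SetLike.mem_coe, Submodule.mem_comap, ContinuousLinearMap.coe_coe, hT₀f]
    exact E.smul_mem _ (hfE k)
  have hM_inv : ∀ x ∈ M, T₀ x ∈ M := fun x hx =>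
    hMcl.symm.subset (map_mem_closure T₀.continuous (hMcl.subset hx) fun y hy => hE_inv hy)
  let T : M →L[ℂ] M := (T₀ ∘L M.subtypeL).codRestrict M fun x => hM_inv x x.2
  have hT : ∀ x : M, ((T x : M) : H) = T₀ x := fun x => rfl
  have hTf : ∀ k (x : M), (x : H) = f k → T x = (lam k)⁻¹ • x := by
    intro k x hx
    ext
    rw [hT, hx, hT₀f, Submodule.coe_smul, hx]
  have hbelow : ∀ x : M, ‖x‖ ≤ (1 + ‖G‖ / c) * ‖T x‖ := by
    intro x
    set α := -(inner ℂ e (x : H) / inner ℂ e G)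
    have h1 : ‖T x‖ = ‖α • G + (x : H)‖ := by
      rw [Submodule.coe_norm, hT, hT₀, LinearIsometryEquiv.norm_map]
    have h2 := hGM' x x.2 α
    have h3 : ‖(x : H)‖ ≤ ‖α • G + (x : H)‖ + ‖α‖ * ‖G‖ := by
      rw [← norm_smul]
      calc ‖(x : H)‖ = ‖(α • G + (x : H)) - α • G‖ := by congr 1; abel
        _ ≤ _ := norm_sub_le _ _
    have h4 : ‖α‖ * ‖G‖ ≤ ‖G‖ / c * ‖T x‖ := by
      rw [h1, div_mul_eq_mul_div, le_div_iff₀ hc]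
      nlinarith [norm_nonneg G]
    rw [h1] at h4 ⊢
    rw [Submodule.coe_norm]
    linarith
  have hanti : AntilipschitzWith (1 + ‖G‖ / c).toNNReal T :=
    T.antilipschitz_of_bound fun x => by
      rw [Real.coe_toNNReal _ (by positivity)]
      exact hbelow x
  have hrange : LinearMap.range (T : M →ₗ[ℂ] M) = ⊤ := by
    have hclosed : IsClosed (LinearMap.range (T : M →ₗ[ℂ] M) : Set M) :=
      hanti.isClosed_range T.uniformContinuous
    rw [eq_top_iff]
    -- The range contains every `f k`, and the preimage in `M` of the span of the `f k` is dense.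
    have hle : E ≤ (LinearMap.range (T : M →ₗ[ℂ] M)).map M.subtype := by
      rw [hE, Submodule.span_le]
      rintro _ ⟨k, rfl⟩
      refine ⟨⟨f k, hEM (hfE k)⟩, ⟨lam k • ⟨f k, hEM (hfE k)⟩, ?_⟩, rfl⟩
      rw [ContinuousLinearMap.coe_coe, map_smul, hTf k _ rfl, smul_inv_smul₀ (hlam k)]
    intro x _
    have hx : (x : H) ∈ closure (E : Set H) := hMcl.subset x.2
    have hcl : IsClosed (((LinearMap.range (T : M →ₗ[ℂ] M)).map M.subtype : Submodule ℂ H) : Set H) := by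
      rw [Submodule.map_coe]
      exact hMclosed.isClosedEmbedding_subtypeVal.isClosedMap _ hclosed
    obtain ⟨y, hy, hyx⟩ := closure_minimal hle hcl hx
    have : y = x := Subtype.ext hyx
    exact this ▸ hy
  have hker : LinearMap.ker (T : M →ₗ[ℂ] M) = ⊥ := LinearMap.ker_eq_bot.2 hanti.injective
  let Te : M ≃L[ℂ] M := ContinuousLinearEquiv.ofBijective T hker hrange
  have hTe : (Te : M →L[ℂ] M) = T := ContinuousLinearEquiv.coe_ofBijective T hker hrange
  let a : M := ContinuousLinearMap.adjoint M.subtypeL e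
  have haM : ∀ x : M, inner ℂ a x = inner ℂ e (x : H) := fun x =>
    ContinuousLinearMap.adjoint_inner_left _ _ _
  have ha : a ≠ 0 := by
    intro h
    have h1 := haM ⟨f 0, hEM (hfE 0)⟩
    rw [h, inner_zero_left] at h1
    have h2 := he 0
    rw [← h1, mul_zero, eq_comm, neg_eq_zero] at h2
    exact heG h2
  obtain ⟨V, R, hV, hR, hVR⟩ := exists_unitary_add_rank_le_one Te a ha (fun x hx => by
    rw [haM] at hx
    change ‖T x‖ = ‖x‖
    rw [Submodule.coe_norm, hT, hT₀, hx, LinearIsometryEquiv.norm_map]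
    simp)
  refine ⟨V, R, hV, hR, fun k x hx => ?_⟩
  rw [← hVR, hTe, hTf k x hx]

/-- The unitary-plus-rank-one operator with eigenvectors `f k` is hypercyclic when its eigenvalues
satisfy the simultaneous recurrence condition of `isHypercyclic_of_eigenvectors`. -/
theorem exists_isHypercyclic_unitary_add_rank_le_one {H : Type} [NormedAddCommGroup H]
    [InnerProductSpace ℂ H] [CompleteSpace H] (S : H ≃ₗᵢ[ℂ] H) (e G : H) (f : ℕ → H) (lam : ℕ → ℂ)
    (hlam : ∀ k, lam k ≠ 0) (hinj : Function.Injective lam) (hS : ∀ k, S (f k) = G + lam k • f k)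
    (he : ∀ k, lam k * inner ℂ e (f k) = -inner ℂ e G) (heG : inner ℂ e G ≠ 0) {c : ℝ}
    (hc : 0 < c) (hG : ∀ m ∈ Submodule.span ℂ (Set.range f), c ≤ ‖G + m‖)
    (hrec : ∀ N : ℕ, ∀ ε > 0, ∃ n : ℕ, ∀ j < N, lam j ^ n = 1 ∧
      ∃ k, lam k ^ n = -1 ∧ ‖f k - f j‖ < ε) :
    ∃ (M : Type) (_ : NormedAddCommGroup M) (_ : InnerProductSpace ℂ M) (_ : CompleteSpace M)
      (V R : M →L[ℂ] M), ¬ FiniteDimensional ℂ M ∧ V ∈ unitary (M →L[ℂ] M) ∧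
      LinearMap.rank (R : M →ₗ[ℂ] M) ≤ 1 ∧ IsHypercyclic (V + R) := by
  set E := Submodule.span ℂ (Set.range f) with hE
  let M := E.topologicalClosure
  have : CompleteSpace M := E.isClosed_topologicalClosure.completeSpace_coe
  obtain ⟨V, R, hV, hR, hVR⟩ :=
    exists_unitary_add_rank_le_one_eigenvectors S e G f lam hlam hS he heG hc hG M rfl
  have hfE : ∀ k, f k ∈ E := fun k => Submodule.subset_span ⟨k, rfl⟩
  let g : ℕ → M := fun k => ⟨f k, E.le_topologicalClosure (hfE k)⟩
  have hg : ∀ k, (V + R) (g k) = (lam k)⁻¹ • g k := fun k => hVR k (g k) rfl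
  refine ⟨M, inferInstance, inferInstance, inferInstance, V, R,
    fun hfin => ?_, hV, hR, ?_⟩
  · have hg0 : ∀ k, g k ≠ 0 := by
      intro k hk
      have hfk : f k = 0 := congrArg Subtype.val hk
      have := hS k
      rw [hfk, map_zero, smul_zero, add_zero] at this
      exact heG (by rw [← this, inner_zero_right])
    have hli : LinearIndependent ℂ g :=
      Module.End.eigenvectors_linearIndependent' ((V + R : M →L[ℂ] M) : M →ₗ[ℂ] M)
        (fun k => (lam k)⁻¹) (inv_injective.comp hinj) g
        fun k => ⟨Module.End.mem_eigenspace_iff.2 (hg k), hg0 k⟩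
    exact not_finite_iff_infinite.2 inferInstance hli.finite
  · refine isHypercyclic_of_eigenvectors (V + R) g (fun k => (lam k)⁻¹) ?_ hg fun N ε hε => ?_
    · have himage : E ≤ (Submodule.span ℂ (Set.range g)).map M.subtype := by
        rw [Submodule.map_span, hE]
        refine Submodule.span_mono ?_
        rintro _ ⟨k, rfl⟩
        exact ⟨g k, ⟨k, rfl⟩, rfl⟩
      intro x
      rw [closure_subtype]
      have hx : (x : H) ∈ closure (E : Set H) := x.2
      exact closure_mono (s := (E : Set H)) (fun y hy => himage hy) hx
    · obtain ⟨n, hn⟩ := hrec N ε hε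
      refine ⟨n, fun j hj => ⟨by rw [inv_pow, (hn j hj).1, inv_one], ?_⟩⟩
      obtain ⟨k, hk, hkj⟩ := (hn j hj).2
      exact ⟨k, by rw [inv_pow, hk]; norm_num, hkj⟩

/-! ### A recurrent sequence of roots of unity -/

/-- The sequence with `rootSeq 0 = 1` and `rootSeq (2 ^ s + i) = rootSeq i * w s` for `i < 2 ^ s`,
where `w s` is a primitive root of unity of order `2 ^ (8 * 2 ^ s + 3)`. Each of the first `2 ^ s`
terms is thus followed by a term which is extremely close to it. -/
noncomputable def rootSeq (k : ℕ) : ℂ :=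
  if k = 0 then 1 else
    rootSeq (k - 2 ^ Nat.log 2 k) *
      Complex.exp (Complex.I * (2 * Real.pi / 2 ^ (8 * 2 ^ Nat.log 2 k + 3) : ℝ))
termination_by k
decreasing_by
  have : 0 < 2 ^ Nat.log 2 k := by positivity
  omega

theorem rootSeq_zero : rootSeq 0 = 1 := by rw [rootSeq, if_pos rfl]

theorem rootSeq_two_pow_add {s i : ℕ} (hi : i < 2 ^ s) :
    rootSeq (2 ^ s + i) =
      rootSeq i * Complex.exp (Complex.I * (2 * Real.pi / 2 ^ (8 * 2 ^ s + 3) : ℝ)) := by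
  have hpos : 0 < 2 ^ s := by positivity
  have hlog : Nat.log 2 (2 ^ s + i) = s :=
    (Nat.log_eq_iff (Or.inr ⟨by norm_num, by omega⟩)).2 ⟨by omega, by rw [pow_succ]; omega⟩
  rw [rootSeq, if_neg (by omega), hlog, Nat.add_sub_cancel_left]

/-- Induction along the recursion of `rootSeq`. -/
theorem two_pow_add_induction {P : ℕ → Prop} (h0 : P 0)
    (h : ∀ s i, i < 2 ^ s → P i → P (2 ^ s + i)) (k : ℕ) : P k := by
  induction k using Nat.strong_induction_on with
  | _ k ih =>
    rcases Nat.eq_zero_or_pos k with rfl | hk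
    · exact h0
    · have h1 := Nat.pow_log_le_self 2 hk.ne'
      have h2 := Nat.lt_pow_succ_log_self (b := 2) (by norm_num) k
      have h3 : 0 < 2 ^ Nat.log 2 k := by positivity
      rw [pow_succ] at h2
      have := h (Nat.log 2 k) (k - 2 ^ Nat.log 2 k) (by omega) (ih _ (by omega))
      rwa [Nat.add_sub_cancel' h1] at this

theorem norm_rootSeq (k : ℕ) : ‖rootSeq k‖ = 1 := by
  induction k using two_pow_add_induction with
  | h0 => simp [rootSeq_zero]
  | h s i hi ih => rw [rootSeq_two_pow_add hi, norm_mul, ih, Complex.norm_exp_I_mul_ofReal, one_mul]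

theorem exp_pow_two_pow_half (e : ℕ) :
    Complex.exp (Complex.I * (2 * Real.pi / 2 ^ (e + 1) : ℝ)) ^ 2 ^ e = -1 := by
  rw [← Complex.exp_nat_mul, ← Complex.exp_pi_mul_I]
  congr 1
  push_cast
  field_simp
  ring

theorem rootSeq_pow_eq_one {k e : ℕ} (he : ∀ t, 2 ^ t ≤ k → 8 * 2 ^ t + 3 ≤ e) :
    rootSeq k ^ 2 ^ e = 1 := by
  induction k using two_pow_add_induction with
  | h0 => simp [rootSeq_zero]
  | h s i hi ih =>
    obtain ⟨d, hd⟩ := Nat.exists_eq_add_of_le (he s (by omega))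
    have h2 : 2 ^ e = 2 ^ (8 * 2 ^ s + 2) * (2 * 2 ^ d) := by rw [hd]; ring
    rw [rootSeq_two_pow_add hi, mul_pow, ih fun t ht => he t (by omega), one_mul, h2, pow_mul,
      exp_pow_two_pow_half (8 * 2 ^ s + 2), pow_mul, neg_one_sq, one_pow]

theorem rootSeq_pow_eq_one_of_lt {s i : ℕ} (hi : i < 2 ^ s) :
    rootSeq i ^ 2 ^ (8 * 2 ^ s + 2) = 1 :=
  rootSeq_pow_eq_one fun t ht => by
    have := (Nat.pow_lt_pow_iff_right (a := 2) (by norm_num)).1 (ht.trans_lt hi)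
    omega

theorem rootSeq_two_pow_add_pow {s i : ℕ} (hi : i < 2 ^ s) :
    rootSeq (2 ^ s + i) ^ 2 ^ (8 * 2 ^ s + 2) = -1 := by
  rw [rootSeq_two_pow_add hi, mul_pow, rootSeq_pow_eq_one_of_lt hi, exp_pow_two_pow_half, one_mul]

theorem norm_rootSeq_two_pow_add_sub_le {s i : ℕ} (hi : i < 2 ^ s) :
    ‖rootSeq (2 ^ s + i) - rootSeq i‖ ≤ (1 / 2) ^ (8 * 2 ^ s) := by
  have h : rootSeq (2 ^ s + i) - rootSeq i = rootSeq i *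
      (Complex.exp (Complex.I * (2 * Real.pi / 2 ^ (8 * 2 ^ s + 3) : ℝ)) - 1) := by
    rw [rootSeq_two_pow_add hi]; ring
  rw [h, norm_mul, norm_rootSeq, one_mul]
  refine (Real.norm_exp_I_mul_ofReal_sub_one_le).trans ?_
  rw [Real.norm_of_nonneg (by positivity), pow_add, one_div_pow, ← div_div, div_right_comm]
  gcongr
  linarith [Real.pi_le_four]

theorem rootSeq_injective : Function.Injective rootSeq := by
  have key : ∀ k j, j < k → rootSeq j ≠ rootSeq k := by
    intro k
    induction k using two_pow_add_induction with
    | h0 => intro j hj; omega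
    | h s i hi ih =>
      intro j hj heq
      have h1 := rootSeq_two_pow_add_pow hi
      rcases lt_or_ge j (2 ^ s) with hjs | hjs
      · rw [← heq, rootSeq_pow_eq_one_of_lt hjs] at h1
        norm_num at h1
      · obtain ⟨j', rfl⟩ := Nat.exists_eq_add_of_le hjs
        rw [rootSeq_two_pow_add hi, rootSeq_two_pow_add (by omega)] at heq
        exact ih j' (by omega) (mul_right_cancel₀ (Complex.exp_ne_zero _) heq)
  intro j k hjk
  rcases lt_trichotomy j k with h | h | h
  · exact absurd hjk (key k j h)
  · exact h
  · exact absurd hjk.symm (key j k h)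

open MeasureTheory Filter Topology

/-! ### Boundary values of functions analytic in the disc -/

instance fact_two_pi_pos : Fact (0 < 2 * Real.pi) := ⟨Real.two_pi_pos⟩

/-- The Hilbert space of square integrable functions on the unit circle, parametrized by the angle
and normalized so that the constant function `1` has norm `1`. -/
abbrev CircleL2 : Type := Lp ℂ 2 (AddCircle.haarAddCircle (T := 2 * Real.pi))

/-- The algebra of functions which are complex differentiable on the closed unit disc. -/
def discAlgebra : Subalgebra ℂ (ℂ → ℂ) where
  carrier := {φ | DifferentiableOn ℂ φ (Metric.closedBall 0 1)}
  mul_mem' h₁ h₂ := h₁.mul h₂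
  add_mem' h₁ h₂ := h₁.add h₂
  algebraMap_mem' c := differentiableOn_const c

/-- The coordinate function `z`. -/
def discAlgebra.coord : discAlgebra := ⟨fun z => z, differentiableOn_id⟩

theorem norm_toCircle (x : AddCircle (2 * Real.pi)) : ‖(x.toCircle : ℂ)‖ = 1 := Circle.norm_coe _

/-- The restriction of a function in `discAlgebra` to the unit circle. -/
noncomputable def discAlgebra.boundary : discAlgebra →ₗ[ℂ] C(AddCircle (2 * Real.pi), ℂ) where
  toFun φ := ⟨fun x => (φ : ℂ → ℂ) x.toCircle,
    (DifferentiableOn.continuousOn φ.2).comp_continuous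
      (continuous_induced_dom.comp AddCircle.continuous_toCircle) fun x => by
        rw [mem_closedBall_zero_iff, norm_toCircle]⟩
  map_add' _ _ := rfl
  map_smul' _ _ := rfl

/-- The boundary function of an element of `discAlgebra`, as a vector of `CircleL2`. -/
noncomputable def discAlgebra.bvec : discAlgebra →ₗ[ℂ] CircleL2 :=
  (ContinuousMap.toLp 2 AddCircle.haarAddCircle ℂ).toLinearMap ∘ₗ discAlgebra.boundary

open discAlgebra

theorem norm_toLp_le_of_ae_le {f g : C(AddCircle (2 * Real.pi), ℂ)} {C : ℝ}
    (h : ∀ᵐ x ∂(AddCircle.haarAddCircle (T := 2 * Real.pi)), ‖f x‖ ≤ C * ‖g x‖) :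
    ‖(ContinuousMap.toLp 2 AddCircle.haarAddCircle ℂ f : CircleL2)‖ ≤
      C * ‖(ContinuousMap.toLp 2 AddCircle.haarAddCircle ℂ g : CircleL2)‖ := by
  refine Lp.norm_le_mul_norm_of_ae_le_mul ?_
  filter_upwards [h, ContinuousMap.coeFn_toLp (p := 2) (𝕜 := ℂ) AddCircle.haarAddCircle f,
    ContinuousMap.coeFn_toLp (p := 2) (𝕜 := ℂ) AddCircle.haarAddCircle g] with x hx hf hg
  rwa [hf, hg]

theorem norm_bvec_le_of_ae_le {φ ψ : discAlgebra} {C : ℝ}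
    (h : ∀ᵐ x ∂(AddCircle.haarAddCircle (T := 2 * Real.pi)),
      ‖(φ : ℂ → ℂ) x.toCircle‖ ≤ C * ‖(ψ : ℂ → ℂ) x.toCircle‖) :
    ‖bvec φ‖ ≤ C * ‖bvec ψ‖ :=
  norm_toLp_le_of_ae_le h

theorem norm_bvec_le {φ ψ : discAlgebra} {C : ℝ}
    (h : ∀ z : ℂ, ‖z‖ = 1 → ‖(φ : ℂ → ℂ) z‖ ≤ C * ‖(ψ : ℂ → ℂ) z‖) :
    ‖bvec φ‖ ≤ C * ‖bvec ψ‖ :=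
  norm_bvec_le_of_ae_le (Eventually.of_forall fun x => h _ (norm_toCircle x))

theorem norm_bvec_mul_le {φ ψ : discAlgebra} {C : ℝ}
    (h : ∀ z : ℂ, ‖z‖ = 1 → ‖(φ : ℂ → ℂ) z‖ ≤ C) : ‖bvec (φ * ψ)‖ ≤ C * ‖bvec ψ‖ :=
  norm_bvec_le fun z hz => by
    change ‖(φ : ℂ → ℂ) z * (ψ : ℂ → ℂ) z‖ ≤ _
    rw [norm_mul]
    exact mul_le_mul_of_nonneg_right (h z hz) (norm_nonneg _)

theorem integral_toCircle_eq_circleAverage (φ : ℂ → ℂ) :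
    ∫ x : AddCircle (2 * Real.pi), φ x.toCircle ∂AddCircle.haarAddCircle =
      Real.circleAverage φ 0 1 := by
  rw [AddCircle.integral_haarAddCircle, Real.circleAverage_def,
    ← AddCircle.intervalIntegral_preimage (2 * Real.pi) 0, zero_add]
  congr 1
  refine intervalIntegral.integral_congr fun θ _ => ?_
  have h : 2 * Real.pi / (2 * Real.pi) = 1 := div_self Real.two_pi_pos.ne'
  simp only [AddCircle.toCircle_apply_mk, h, one_mul, Circle.coe_exp, circleMap, zero_add,
    Complex.ofReal_one]

/-- The mean value property: the mean of the boundary function is the value at the centre. -/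
theorem inner_bvec_one (φ : discAlgebra) : inner ℂ (bvec 1) (bvec φ) = (φ : ℂ → ℂ) 0 := by
  have hφ : DiffContOnCl ℂ (φ : ℂ → ℂ) (Metric.ball 0 |1|) := by
    rw [abs_one]
    refine DifferentiableOn.diffContOnCl ?_
    rw [closure_ball _ one_ne_zero]
    exact φ.2
  rw [← hφ.circleAverage, ← integral_toCircle_eq_circleAverage]
  refine (ContinuousMap.inner_toLp (𝕜 := ℂ) AddCircle.haarAddCircle (boundary 1)
    (boundary φ)).trans (integral_congr_ae (Eventually.of_forall fun x => ?_))
  have h1 : boundary 1 x = 1 := rfl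
  simp only [h1, map_one, mul_one]
  rfl

theorem norm_bvec_one : ‖bvec 1‖ = 1 := by
  have h : inner ℂ (bvec 1) (bvec 1) = (1 : ℂ) := inner_bvec_one 1
  rw [inner_self_eq_norm_sq_to_K] at h
  have h' : ‖bvec 1‖ ^ 2 = 1 := Complex.ofReal_injective (by simpa using h)
  exact (pow_eq_one_iff_of_nonneg (norm_nonneg _) two_ne_zero).1 h'

theorem norm_apply_zero_le_norm_bvec (φ : discAlgebra) : ‖(φ : ℂ → ℂ) 0‖ ≤ ‖bvec φ‖ := by
  rw [← inner_bvec_one]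
  simpa [norm_bvec_one] using norm_inner_le_norm (𝕜 := ℂ) (bvec 1) (bvec φ)

theorem haarAddCircle_singleton (x : AddCircle (2 * Real.pi)) :
    AddCircle.haarAddCircle {x} = 0 := by
  have h := AddCircle.volume_closedBall (2 * Real.pi) (x := x) 0
  rw [Metric.closedBall_zero, AddCircle.volume_eq_smul_haarAddCircle] at h
  simpa [Real.two_pi_pos.not_ge, Real.pi_pos.not_ge, Real.pi_pos.le] using h

theorem ae_toCircle_ne (w : ℂ) :
    ∀ᵐ x ∂(AddCircle.haarAddCircle (T := 2 * Real.pi)), (x.toCircle : ℂ) ≠ w := by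
  by_cases h : ∃ y : AddCircle (2 * Real.pi), (y.toCircle : ℂ) = w
  · obtain ⟨y, rfl⟩ := h
    refine measure_mono_null (t := {y}) (fun x hx => ?_) (haarAddCircle_singleton y)
    have hx' : (x.toCircle : ℂ) = y.toCircle := by simpa using hx
    exact AddCircle.injective_toCircle Real.two_pi_pos.ne' (Circle.coe_injective hx')
  · push Not at h
    exact Eventually.of_forall h

/-- Multiplication by the coordinate, a unitary operator. -/
theorem exists_mul_coord_isometry :
    ∃ S : CircleL2 ≃ₗᵢ[ℂ] CircleL2, ∀ φ, S (bvec φ) = bvec (coord * φ) := by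
  let ζ : C(AddCircle (2 * Real.pi), ℂ) := boundary coord
  have hζ : ∀ x, ‖ζ x‖ = 1 := norm_toCircle
  have hζ' : ∀ x, star (ζ x) * ζ x = 1 := fun x => by
    change (starRingEnd ℂ) (ζ x) * ζ x = 1
    rw [← Complex.normSq_eq_conj_mul_self, Complex.normSq_eq_norm_sq, hζ]
    simp
  let m : C(AddCircle (2 * Real.pi), ℂ) ≃ₗ[ℂ] C(AddCircle (2 * Real.pi), ℂ) :=
    { toFun := fun f => ζ * f
      invFun := fun f => star ζ * f
      map_add' := fun f g => mul_add _ _ _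
      map_smul' := fun c f => mul_smul_comm _ _ _
      left_inv := fun f => by
        ext x
        change star (ζ x) * (ζ x * f x) = f x
        rw [← mul_assoc, hζ', one_mul]
      right_inv := fun f => by
        ext x
        change ζ x * (star (ζ x) * f x) = f x
        rw [← mul_assoc, mul_comm (ζ x), hζ', one_mul] }
  have hnorm : ∀ f x, ‖m f x‖ = ‖f x‖ := fun f x => by
    change ‖ζ x * f x‖ = _
    rw [norm_mul, hζ, one_mul]
  let e : C(AddCircle (2 * Real.pi), ℂ) →ₗ[ℂ] CircleL2 :=
    (ContinuousMap.toLp 2 AddCircle.haarAddCircle ℂ).toLinearMap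
  have hdense : DenseRange e :=
    ContinuousMap.toLp_denseRange ℂ AddCircle.haarAddCircle ℂ (by norm_num)
  have he : ∀ f, ‖e (m f)‖ = ‖e f‖ := by
    intro f
    refine le_antisymm ?_ ?_
    · rw [← one_mul ‖e f‖]
      exact norm_toLp_le_of_ae_le (f := m f) (g := f) (C := 1)
        (Eventually.of_forall fun x => by rw [hnorm, one_mul])
    · rw [← one_mul ‖e (m f)‖]
      exact norm_toLp_le_of_ae_le (f := f) (g := m f) (C := 1)
        (Eventually.of_forall fun x => by rw [hnorm, one_mul])
  exact ⟨m.extendOfIsometry e e hdense hdense he, fun φ =>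
    LinearEquiv.extendOfIsometry_eq m e e hdense hdense he (boundary φ)⟩

/-! ### A product of Blaschke-like factors with zeros on the circle -/

/-- A point at distance `(1 / 4) ^ k` outside the disc, on the ray through `rootSeq k`. -/
noncomputable def outerPole (k : ℕ) : ℂ := rootSeq k * (1 + (1 / 4) ^ k)

theorem le_norm_sub_outerPole (k : ℕ) {z : ℂ} (hz : ‖z‖ ≤ 1) : (1 / 4) ^ k ≤ ‖z - outerPole k‖ := by
  have h1 : ‖outerPole k‖ = 1 + (1 / 4) ^ k := by
    rw [outerPole, norm_mul, norm_rootSeq, one_mul]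
    have : (1 + (1 / 4) ^ k : ℂ) = ((1 + (1 / 4) ^ k : ℝ) : ℂ) := by push_cast; rfl
    rw [this, Complex.norm_of_nonneg (by positivity)]
  have h2 := norm_sub_norm_le (outerPole k) z
  rw [norm_sub_rev] at h2
  linarith

/-- The function `1 / (z - outerPole k)`. -/
noncomputable def poleFun (k : ℕ) : discAlgebra :=
  ⟨fun z => (z - outerPole k)⁻¹, (differentiableOn_id.sub_const _).inv fun z hz h => by
    have h1 := le_norm_sub_outerPole k (mem_closedBall_zero_iff.1 hz)
    have h2 : (0 : ℝ) < (1 / 4) ^ k := by positivity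
    rw [show z - outerPole k = 0 from h, norm_zero] at h1
    linarith⟩

/-- The factor `(z - rootSeq k) / (z - outerPole k)`, which is bounded by `1` on the disc, vanishes
at `rootSeq k`, and is close to `1` away from that point. -/
noncomputable def zeroFactor (k : ℕ) : discAlgebra := (coord - rootSeq k • 1) * poleFun k

/-- The product of the first `n` factors. -/
noncomputable def partialProd (n : ℕ) : discAlgebra := ∏ i ∈ Finset.range n, zeroFactor i

/-- For `k < n`, the function `partialProd n / (z - rootSeq k)`. -/
noncomputable def prodQuot (n k : ℕ) : discAlgebra :=
  poleFun k * ∏ i ∈ (Finset.range n).erase k, zeroFactor i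

/-- Evaluation at a point, as a ring homomorphism. -/
def evalAt (z : ℂ) : discAlgebra →+* ℂ := (Pi.evalRingHom (fun _ : ℂ => ℂ) z).comp
  discAlgebra.val.toRingHom

theorem evalAt_apply (z : ℂ) (φ : discAlgebra) : evalAt z φ = (φ : ℂ → ℂ) z := rfl

theorem evalAt_smul (z c : ℂ) (φ : discAlgebra) : evalAt z (c • φ) = c * evalAt z φ := rfl

theorem evalAt_coord (z : ℂ) : evalAt z coord = z := rfl

theorem evalAt_zeroFactor (z : ℂ) (k : ℕ) :
    evalAt z (zeroFactor k) = (z - rootSeq k) * (z - outerPole k)⁻¹ := by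
  rw [zeroFactor, map_mul, map_sub, evalAt_smul, map_one, mul_one]
  rfl

theorem coord_mul_prodQuot {n k : ℕ} (hk : k < n) :
    coord * prodQuot n k = partialProd n + rootSeq k • prodQuot n k := by
  have h : (coord - rootSeq k • 1) * prodQuot n k = partialProd n := by
    rw [prodQuot, ← mul_assoc, ← zeroFactor, partialProd]
    exact Finset.mul_prod_erase _ _ (Finset.mem_range.2 hk)
  rw [← h, sub_mul, smul_mul_assoc, one_mul, sub_add_cancel]

theorem norm_evalAt_poleFun_le (k : ℕ) {z : ℂ} (hz : ‖z‖ = 1) : ‖evalAt z (poleFun k)‖ ≤ 4 ^ k := by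
  change ‖(z - outerPole k)⁻¹‖ ≤ _
  rw [norm_inv]
  refine inv_le_of_inv_le₀ (by positivity) ?_
  have := le_norm_sub_outerPole k hz.le
  rwa [one_div_pow, one_div] at this

theorem norm_evalAt_zeroFactor_le (k : ℕ) {z : ℂ} (hz : ‖z‖ = 1) :
    ‖evalAt z (zeroFactor k)‖ ≤ 1 := by
  have hpos : (0 : ℝ) < (1 / 4) ^ k := by positivity
  rw [evalAt_zeroFactor, norm_mul, norm_inv]
  refine mul_inv_le_one_of_le₀ ?_ (norm_nonneg _)
  -- The pole lies on the ray through the zero, further away from the disc.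
  have hl := norm_rootSeq k
  set w := rootSeq k
  have hc : (w * (1 + (1 / 4) ^ k) : ℂ) = ((1 + (1 / 4) ^ k : ℝ) : ℂ) * w := by push_cast; ring
  rw [outerPole, hc]
  set r : ℝ := (1 / 4) ^ k
  rw [← sq_le_sq₀ (norm_nonneg _) (norm_nonneg _), ← Complex.normSq_eq_norm_sq,
    ← Complex.normSq_eq_norm_sq]
  have h1 : z.re * z.re + z.im * z.im = 1 := by
    rw [← Complex.normSq_apply, Complex.normSq_eq_norm_sq, hz, one_pow]
  have h2 : w.re * w.re + w.im * w.im = 1 := by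
    rw [← Complex.normSq_apply, Complex.normSq_eq_norm_sq, hl, one_pow]
  have h3 : z.re * w.re + z.im * w.im ≤ 1 := by
    nlinarith [sq_nonneg (z.re - w.re), sq_nonneg (z.im - w.im)]
  simp only [Complex.normSq_apply, Complex.sub_re, Complex.sub_im, Complex.re_ofReal_mul,
    Complex.im_ofReal_mul]
  have h4 : (z.re - (1 + r) * w.re) * (z.re - (1 + r) * w.re) +
      (z.im - (1 + r) * w.im) * (z.im - (1 + r) * w.im) =
      (z.re - w.re) * (z.re - w.re) + (z.im - w.im) * (z.im - w.im) +
        2 * r * (1 - (z.re * w.re + z.im * w.im)) + r ^ 2 := by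
    linear_combination (2 * r + r ^ 2) * h2
  rw [h4]
  nlinarith [mul_nonneg hpos.le (sub_nonneg.2 h3), sq_nonneg r]

theorem norm_evalAt_prod_le (s : Finset ℕ) {z : ℂ} (hz : ‖z‖ = 1) :
    ‖evalAt z (∏ i ∈ s, zeroFactor i)‖ ≤ 1 := by
  rw [map_prod, norm_prod]
  exact Finset.prod_le_one (fun _ _ => norm_nonneg _) fun i _ => norm_evalAt_zeroFactor_le i hz

theorem evalAt_zero_zeroFactor (k : ℕ) :
    evalAt 0 (zeroFactor k) = (((1 + (1 / 4) ^ k)⁻¹ : ℝ) : ℂ) := by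
  have h : rootSeq k ≠ 0 := norm_ne_zero_iff.1 (by rw [norm_rootSeq]; exact one_ne_zero)
  rw [evalAt_zeroFactor, outerPole, zero_sub, zero_sub, inv_neg, neg_mul_neg, mul_inv,
    mul_inv_cancel_left₀ h]
  push_cast
  rfl

/-- Since `zeroFactor k` is bounded by `1` on the circle, the distance to the constant `1` is
controlled by its value at the centre. -/
theorem norm_bvec_zeroFactor_sub_one_le (k : ℕ) : ‖bvec (zeroFactor k - 1)‖ ≤ 2 * (1 / 2) ^ k := by
  have h1 : ‖bvec (zeroFactor k)‖ ≤ 1 := by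
    have := norm_bvec_mul_le (φ := zeroFactor k) (ψ := 1) (C := 1)
      fun z hz => norm_evalAt_zeroFactor_le k hz
    rwa [mul_one, norm_bvec_one, one_mul] at this
  have h2 : RCLike.re (inner ℂ (bvec (zeroFactor k)) (bvec 1)) = (1 + (1 / 4 : ℝ) ^ k)⁻¹ := by
    rw [inner_re_symm, inner_bvec_one, ← evalAt_apply, evalAt_zero_zeroFactor]
    exact Complex.ofReal_re _
  have h3 := norm_sub_sq (𝕜 := ℂ) (bvec (zeroFactor k)) (bvec 1)
  rw [h2, norm_bvec_one] at h3
  have hpos : (0 : ℝ) < (1 / 4) ^ k := by positivity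
  have h4 : 1 - (1 / 4 : ℝ) ^ k ≤ (1 + (1 / 4) ^ k)⁻¹ := by
    rw [← one_div, le_div_iff₀ (by positivity)]
    nlinarith
  have h5 : (2 * (1 / 2 : ℝ) ^ k) ^ 2 = 4 * (1 / 4) ^ k := by
    rw [mul_pow, ← pow_mul, mul_comm k, pow_mul]
    norm_num
  rw [map_sub, ← sq_le_sq₀ (norm_nonneg _) (by positivity), h3, h5]
  nlinarith [norm_nonneg (bvec (zeroFactor k))]

/-! ### Passage to the limit in the Hilbert space -/

theorem dist_bvec_partialProd_le (n : ℕ) :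
    dist (bvec (partialProd n)) (bvec (partialProd (n + 1))) ≤ 2 * (1 / 2) ^ n := by
  have h : partialProd (n + 1) - partialProd n = partialProd n * (zeroFactor n - 1) := by
    rw [partialProd, Finset.prod_range_succ, mul_sub, mul_one]
    rfl
  rw [dist_comm, dist_eq_norm, ← map_sub, h]
  refine (norm_bvec_mul_le (C := 1) fun z hz => norm_evalAt_prod_le _ hz).trans ?_
  rw [one_mul]
  exact norm_bvec_zeroFactor_sub_one_le n

theorem dist_bvec_prodQuot_le (n k : ℕ) :
    dist (bvec (prodQuot n k)) (bvec (prodQuot (n + 1) k)) ≤ 4 ^ k * 2 * (1 / 2) ^ n := by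
  rcases eq_or_ne n k with rfl | hnk
  · have h : prodQuot (n + 1) n = prodQuot n n := by
      rw [prodQuot, prodQuot, Finset.range_add_one, Finset.erase_insert_eq_erase]
    rw [h, dist_self]
    positivity
  · have h : prodQuot (n + 1) k - prodQuot n k = prodQuot n k * (zeroFactor n - 1) := by
      rw [prodQuot, Finset.range_add_one, Finset.erase_insert_of_ne hnk,
        Finset.prod_insert (by simp), prodQuot]
      ring
    rw [dist_comm, dist_eq_norm, ← map_sub, h]
    refine (norm_bvec_mul_le (C := 4 ^ k) fun z hz => ?_).trans ?_
    · change ‖evalAt z (prodQuot n k)‖ ≤ _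
      rw [prodQuot, map_mul, norm_mul]
      exact (mul_le_mul (norm_evalAt_poleFun_le k hz) (norm_evalAt_prod_le _ hz) (norm_nonneg _)
        (by positivity)).trans (mul_one _).le
    · rw [mul_assoc]
      exact mul_le_mul_of_nonneg_left (norm_bvec_zeroFactor_sub_one_le n) (by positivity)

theorem norm_bvec_prodQuot_sub_le {n j k : ℕ} (hj : j < n) (hk : k < n) (hjk : j ≠ k) :
    ‖bvec (prodQuot n k) - bvec (prodQuot n j)‖ ≤
      ‖rootSeq k - rootSeq j‖ * (4 ^ k * 4 ^ j) := by
  have h : prodQuot n k - prodQuot n j = (rootSeq k - rootSeq j) •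
      ((poleFun k * poleFun j * ∏ i ∈ ((Finset.range n).erase k).erase j, zeroFactor i) * 1) := by
    rw [prodQuot, prodQuot,
      ← Finset.mul_prod_erase ((Finset.range n).erase k) zeroFactor
        (Finset.mem_erase.2 ⟨hjk, Finset.mem_range.2 hj⟩),
      ← Finset.mul_prod_erase ((Finset.range n).erase j) zeroFactor
        (Finset.mem_erase.2 ⟨hjk.symm, Finset.mem_range.2 hk⟩),
      Finset.erase_right_comm (a := j), zeroFactor, zeroFactor]
    simp only [Algebra.smul_def, map_sub]
    ring
  rw [← map_sub, h, map_smul, norm_smul]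
  refine mul_le_mul_of_nonneg_left ?_ (norm_nonneg _)
  refine (norm_bvec_mul_le (C := 4 ^ k * 4 ^ j) fun z hz => ?_).trans
    (by rw [norm_bvec_one, mul_one])
  rw [← evalAt_apply, map_mul, map_mul, norm_mul, norm_mul]
  exact (mul_le_mul (mul_le_mul (norm_evalAt_poleFun_le k hz) (norm_evalAt_poleFun_le j hz)
    (norm_nonneg _) (by positivity)) (norm_evalAt_prod_le _ hz) (norm_nonneg _)
    (by positivity)).trans (mul_one _).le

theorem exp_neg_two_le_norm_evalAt_partialProd (n : ℕ) :
    Real.exp (-2) ≤ ‖evalAt 0 (partialProd n)‖ := by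
  have h1 : ∏ i ∈ Finset.range n, (1 + (1 / 4 : ℝ) ^ i) ≤ Real.exp 2 := by
    have h2 : ∑ i ∈ Finset.range n, (1 / 4 : ℝ) ^ i ≤ 2 := by
      rw [geom_sum_eq (by norm_num), div_le_iff_of_neg (by norm_num)]
      have : (0 : ℝ) < (1 / 4) ^ n := by positivity
      linarith
    calc _ ≤ ∏ i ∈ Finset.range n, Real.exp ((1 / 4 : ℝ) ^ i) :=
          Finset.prod_le_prod (fun _ _ => by positivity) fun i _ => by
            rw [add_comm]; exact Real.add_one_le_exp _
      _ = Real.exp (∑ i ∈ Finset.range n, (1 / 4 : ℝ) ^ i) := (Real.exp_sum _ _).symm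
      _ ≤ _ := Real.exp_le_exp.2 h2
  rw [partialProd, map_prod, norm_prod, Real.exp_neg]
  have h3 : ∀ i, ‖evalAt 0 (zeroFactor i)‖ = (1 + (1 / 4 : ℝ) ^ i)⁻¹ := fun i => by
    rw [evalAt_zero_zeroFactor, Complex.norm_of_nonneg (by positivity)]
  simp only [h3, Finset.prod_inv_distrib]
  exact inv_anti₀ (Finset.prod_pos fun _ _ => by positivity) h1

/-- On the unit circle `|Φ| = |Θ|` for `Φ = G + ∑ aₖ Fₖ` and `Θ = G - ∑ conj aₖ rₖ z Fₖ`, where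
`G = (z - rₖ) Fₖ`, and `Θ` has the same value as `G` at the centre of the disc. So the mean value
property for `Θ` bounds the distance from `G` to the span of the functions `Fₖ`. -/
theorem norm_evalAt_zero_partialProd_le (n : ℕ) (s : Finset ℕ) (hs : ∀ k ∈ s, k < n) (a : ℕ → ℂ) :
    ‖evalAt 0 (partialProd n)‖ ≤ ‖bvec (partialProd n + ∑ k ∈ s, a k • prodQuot n k)‖ := by
  set Φ := partialProd n + ∑ k ∈ s, a k • prodQuot n k with hΦ
  set Θ := partialProd n - ∑ k ∈ s, ((starRingEnd ℂ) (a k) * rootSeq k) • (coord * prodQuot n k)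
    with hΘ
  have h0 : evalAt 0 Θ = evalAt 0 (partialProd n) := by
    simp only [hΘ, map_sub, map_sum, evalAt_smul, map_mul, evalAt_coord, zero_mul, mul_zero,
      Finset.sum_const_zero, sub_zero]
  have hle : ‖bvec Θ‖ ≤ 1 * ‖bvec Φ‖ := by
    refine norm_bvec_le_of_ae_le ?_
    have hae : ∀ᵐ x ∂(AddCircle.haarAddCircle (T := 2 * Real.pi)), ∀ i ∈ Finset.range n,
        (x.toCircle : ℂ) ≠ rootSeq i :=
      (Finset.eventually_all _).2 fun i _ => ae_toCircle_ne _
    filter_upwards [hae] with x hx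
    have hz := norm_toCircle x
    set z := (x.toCircle : ℂ)
    rw [one_mul, ← evalAt_apply, ← evalAt_apply]
    have hG : evalAt z (partialProd n) ≠ 0 := by
      rw [partialProd, map_prod, Finset.prod_ne_zero_iff]
      intro i hi
      rw [evalAt_zeroFactor]
      refine mul_ne_zero (sub_ne_zero.2 (hx i hi)) (inv_ne_zero fun h => ?_)
      have h1 := le_norm_sub_outerPole i hz.le
      rw [h, norm_zero] at h1
      exact absurd h1 (not_le.2 (by positivity))
    have hconj : ∀ w : ℂ, ‖w‖ = 1 → w * (starRingEnd ℂ) w = 1 := fun w hw => by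
      rw [Complex.mul_conj, Complex.normSq_eq_norm_sq, hw]
      simp
    have key : (starRingEnd ℂ) (evalAt z Θ) * evalAt z (partialProd n) =
        (starRingEnd ℂ) (evalAt z (partialProd n)) * evalAt z Φ := by
      simp only [hΘ, hΦ, map_sub, map_add, map_sum, evalAt_smul, map_mul, evalAt_coord,
        Complex.conj_conj, sub_mul, mul_add, Finset.sum_mul, Finset.mul_sum]
      rw [mul_comm, sub_eq_add_neg, ← Finset.sum_neg_distrib]
      rw [mul_comm]
      congr 1
      refine Finset.sum_congr rfl fun k hk => ?_
      have hGk : evalAt z (partialProd n) = (z - rootSeq k) * evalAt z (prodQuot n k) := by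
        have := congrArg (evalAt z) (coord_mul_prodQuot (hs k hk))
        rw [map_mul, map_add, evalAt_smul, evalAt_coord] at this
        linear_combination -this
      rw [hGk]
      simp only [map_mul, map_sub]
      linear_combination (a k * (starRingEnd ℂ) (evalAt z (prodQuot n k)) *
        evalAt z (prodQuot n k)) * ((starRingEnd ℂ) z * hconj _ (norm_rootSeq k) -
          (starRingEnd ℂ) (rootSeq k) * hconj _ hz)
    have hn := congrArg norm key
    rw [norm_mul, norm_mul, RCLike.norm_conj, RCLike.norm_conj, mul_comm] at hn
    exact (mul_left_cancel₀ (norm_ne_zero_iff.2 hG) hn).le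
  rw [one_mul] at hle
  rw [← h0]
  exact (norm_apply_zero_le_norm_bvec Θ).trans hle

theorem exists_tendsto_bvec_partialProd :
    ∃ G, Tendsto (fun n => bvec (partialProd n)) atTop (𝓝 G) :=
  cauchySeq_tendsto_of_complete
    (cauchySeq_of_le_geometric (1 / 2) 2 (by norm_num) dist_bvec_partialProd_le)

theorem exists_tendsto_bvec_prodQuot (k : ℕ) :
    ∃ f, Tendsto (fun n => bvec (prodQuot n k)) atTop (𝓝 f) :=
  cauchySeq_tendsto_of_complete
    (cauchySeq_of_le_geometric (1 / 2) (4 ^ k * 2) (by norm_num) fun n => dist_bvec_prodQuot_le n k)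

/-- At stage `s`, all points `rootSeq j` with `j < 2 ^ s` recur simultaneously, and the vectors
`f (2 ^ s + j)` are close to `f j` because the distance of the points `rootSeq (2 ^ s + j)` and
`rootSeq j` is negligible in comparison with the product of their distances to the poles. -/
theorem exists_pow_rootSeq_and_norm_sub_lt {X : Type*} [NormedAddCommGroup X] (f : ℕ → X)
    (hf : ∀ j k, j ≠ k → ‖f k - f j‖ ≤ ‖rootSeq k - rootSeq j‖ * (4 ^ k * 4 ^ j))
    (N : ℕ) {ε : ℝ} (hε : 0 < ε) :
    ∃ n : ℕ, ∀ j < N, rootSeq j ^ n = 1 ∧ ∃ k, rootSeq k ^ n = -1 ∧ ‖f k - f j‖ < ε := by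
  obtain ⟨t, ht⟩ := exists_pow_lt_of_lt_one hε (by norm_num : (1 / 2 : ℝ) < 1)
  set s := max N t
  have hs : s < 2 ^ s := Nat.lt_two_pow_self
  refine ⟨2 ^ (8 * 2 ^ s + 2), fun j hj => ?_⟩
  have hjs : j < 2 ^ s := by omega
  refine ⟨rootSeq_pow_eq_one_of_lt hjs, 2 ^ s + j, rootSeq_two_pow_add_pow hjs, ?_⟩
  have h4 : (4 : ℝ) ^ (2 ^ s + j) * 4 ^ j ≤ 2 ^ (6 * 2 ^ s) := by
    rw [← pow_add, show (4 : ℝ) = 2 ^ 2 by norm_num, ← pow_mul]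
    exact pow_le_pow_right₀ (by norm_num) (by omega)
  calc ‖f (2 ^ s + j) - f j‖
      ≤ ‖rootSeq (2 ^ s + j) - rootSeq j‖ * (4 ^ (2 ^ s + j) * 4 ^ j) := hf _ _ (by omega)
    _ ≤ (1 / 2) ^ (8 * 2 ^ s) * 2 ^ (6 * 2 ^ s) :=
        mul_le_mul (norm_rootSeq_two_pow_add_sub_le hjs) h4 (by positivity) (by positivity)
    _ = (1 / 2) ^ (2 * 2 ^ s) := by
        rw [show 8 * 2 ^ s = 2 * 2 ^ s + 6 * 2 ^ s by ring, pow_add, mul_assoc, ← mul_pow]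
        norm_num
    _ ≤ (1 / 2) ^ t := pow_le_pow_of_le_one (by norm_num) (by norm_num) (by omega)
    _ < ε := ht

theorem exists_isHypercyclic_unitary_add_rank_one_operator :
    ∃ (M : Type) (_ : NormedAddCommGroup M) (_ : InnerProductSpace ℂ M) (_ : CompleteSpace M)
      (V R : M →L[ℂ] M), ¬ FiniteDimensional ℂ M ∧ V ∈ unitary (M →L[ℂ] M) ∧
      LinearMap.rank (R : M →ₗ[ℂ] M) ≤ 1 ∧ IsHypercyclic (V + R) := by
  obtain ⟨S, hS⟩ := exists_mul_coord_isometry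
  obtain ⟨G, hG⟩ := exists_tendsto_bvec_partialProd
  choose f hf using exists_tendsto_bvec_prodQuot
  have hbig : ∀ n, Real.exp (-2) ≤ ‖evalAt 0 (partialProd n)‖ :=
    exp_neg_two_le_norm_evalAt_partialProd
  have hinnerG : Tendsto (fun n => evalAt 0 (partialProd n)) atTop (𝓝 (inner ℂ (bvec 1) G)) := by
    have := (tendsto_const_nhds (x := bvec 1)).inner (𝕜 := ℂ) hG
    simpa only [inner_bvec_one, evalAt_apply] using this
  have hinnerf : ∀ k, Tendsto (fun n => evalAt 0 (prodQuot n k)) atTop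
      (𝓝 (inner ℂ (bvec 1) (f k))) := fun k => by
    have := (tendsto_const_nhds (x := bvec 1)).inner (𝕜 := ℂ) (hf k)
    simpa only [inner_bvec_one, evalAt_apply] using this
  refine exists_isHypercyclic_unitary_add_rank_le_one S (bvec 1) G f rootSeq
    (fun k => norm_ne_zero_iff.1 (by rw [norm_rootSeq]; exact one_ne_zero)) rootSeq_injective
    (fun k => ?_) (fun k => ?_) ?_ (Real.exp_pos (-2)) (fun m hm => ?_)
    fun N ε hε => exists_pow_rootSeq_and_norm_sub_lt f (fun j k hjk => ?_) N hε
  · refine tendsto_nhds_unique ((S.continuous.tendsto _).comp (hf k))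
      ((hG.add ((hf k).const_smul (rootSeq k))).congr' ?_)
    filter_upwards [eventually_gt_atTop k] with n hn
    rw [Function.comp_apply, hS, coord_mul_prodQuot hn, map_add, map_smul]
  · refine tendsto_nhds_unique ((hinnerf k).const_mul (rootSeq k)) (hinnerG.neg.congr' ?_)
    filter_upwards [eventually_gt_atTop k] with n hn
    have := congrArg (evalAt 0) (coord_mul_prodQuot hn)
    rw [map_mul, map_add, evalAt_smul, evalAt_coord, zero_mul] at this
    linear_combination this
  · refine norm_pos_iff.1 ((Real.exp_pos (-2)).trans_le ?_)
    exact ge_of_tendsto hinnerG.norm (Eventually.of_forall hbig)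
  · obtain ⟨a, rfl⟩ := (Finsupp.mem_span_range_iff_exists_finsupp).1 hm
    have hlim : Tendsto (fun n => bvec (partialProd n + ∑ k ∈ a.support, a k • prodQuot n k)) atTop
        (𝓝 (G + ∑ k ∈ a.support, a k • f k)) := by
      simp only [map_add, map_sum, map_smul]
      exact hG.add (tendsto_finsetSum _ fun k _ => (hf k).const_smul _)
    refine ge_of_tendsto hlim.norm ?_
    filter_upwards [eventually_gt_atTop (a.support.sup id)] with n hn
    exact (hbig n).trans (norm_evalAt_zero_partialProd_le n _
      (fun k hk => (Finset.le_sup (f := id) hk).trans_lt hn) a)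
  · refine le_of_tendsto ((hf k).sub (hf j)).norm ?_
    filter_upwards [eventually_gt_atTop j, eventually_gt_atTop k] with n hj hk
    exact norm_bvec_prodQuot_sub_le hj hk hjk

theorem theorem1 :
    (∃ (H : Type) (_ : NormedAddCommGroup H) (_ : InnerProductSpace ℂ H) (_ : CompleteSpace H)
      (V R : H →L[ℂ] H),
      ¬ FiniteDimensional ℂ H ∧
      V ∈ unitary (H →L[ℂ] H) ∧
      LinearMap.rank (R : H →ₗ[ℂ] H) ≤ 2 ∧
      IsHypercyclic (V + R)) ∧
    (∃ (H : Type) (_ : NormedAddCommGroup H) (_ : InnerProductSpace ℂ H) (_ : CompleteSpace H)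
      (A F : H →L[ℂ] H),
      ¬ FiniteDimensional ℂ H ∧
      IsHyponormal A ∧
      FiniteDimensional ℂ (LinearMap.range (F : H →ₗ[ℂ] H)) ∧
      IsSupercyclic (A + F)) := by
  obtain ⟨H, i₁, i₂, i₃, V, R, hH, hV, hR, hVR⟩ :=
    exists_isHypercyclic_unitary_add_rank_one_operator
  refine ⟨⟨H, i₁, i₂, i₃, V, R, hH, hV, hR.trans (by norm_num), hVR⟩,
    ⟨H, i₁, i₂, i₃, V, R, hH, isHyponormal_of_mem_unitary hV, ?_, hVR.isSupercyclic⟩⟩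
  exact Module.rank_lt_aleph0_iff.1 (hR.trans_lt Cardinal.one_lt_aleph0)
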